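/- Let $X$ be a separable metrizable topological space, and let $B_1(X)$ be the space of all Baire-one functions on $X$, i.e. of all functions $f:X\to\mathbb R$ that are pointwise limits of sequences of continuous functions $X\to\mathbb R$, endowed with the topology of pointwise convergence (the topology induced from $\mathbb R^X$). Then: (i) $B_1(X)$ is Polish if and only if $X$ is countable; (ii) $B_1(X)$ is complete (every Cauchy net in the topological vector space $B_1(X)$ converges in it) if and only if $B_1(X)=\mathbb R^X$, and if and only if $X$ is a $Q$-set, i.e. every subset of $X$ is a $G_\delta$-set in $X$; (iii) $B_1(X)$ is sequentially complete (every Cauchy sequence in $B_1(X)$ converges in it) if and only if $X$ is a $\sigma$-set, i.e. every $F_\sigma$-subset of $X$ is a $G_\delta$-set in $X$; (iv) $B_1(X)$ is a Choquet space if and only if $X$ is a $\lambda$-set, i.e. every countable subset of $X$ is a $G_\delta$-set in $X$; (v) $B_1(X)$ is a Baire space if and only if $X$ is a $\kappa$-set, i.e. for every sequence $(M_n)_{n\in\mathbb N}$ of pairwise disjoint finite subsets of $X$ there is an infinite set $A\subseteq\mathbb N$ such that $\bigcup_{n\in A}M_n$ is a $G_\delta$-set in $X$. Here a topological space $Y$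 is a Choquet space if the second player has a winning strategy in the Choquet game on $Y$: two players alternately choose nonempty open sets $U_0\supseteq V_0\supseteq U_1\supseteq V_1\supseteq\cdots$ of $Y$, the first player choosing the $U_n$ and the second the $V_n$, and the second player wins if $\bigcap_n V_n\ne\emptyset$. -/

import Mathlib

open Filter Topology TopologicalSpace

/-- The locally convex space `B₁(X)` of Baire-one functions on `X`, that is, of pointwise limits of
sequences of continuous real-valued functions. As a linear subspace of the product `X → ℝ` it
carries the pointwise topology and the corresponding (additive group) uniformity. -/
def baireOne (X : Type*) [TopologicalSpace X] : Submodule ℝ (X → ℝ) where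
  carrier := {f | ∃ u : ℕ → C(X, ℝ), ∀ x, Tendsto (fun n => u n x) atTop (𝓝 (f x))}
  zero_mem' := ⟨fun _ => 0, fun _ => by simp⟩
  add_mem' := by
    rintro f g ⟨u, hu⟩ ⟨v, hv⟩
    exact ⟨fun n => u n + v n, fun x => by simpa using (hu x).add (hv x)⟩
  smul_mem' := by
    rintro c f ⟨u, hu⟩
    exact ⟨fun n => c • u n, fun x => by simpa using (hu x).const_mul c⟩

/-- Every Cauchy sequence converges. -/
def IsSequentiallyComplete (E : Type*) [UniformSpace E] : Prop :=
  ∀ u : ℕ → E, CauchySeq u → ∃ a, Tendsto u atTop (𝓝 a)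

/-- `F_σ`-sets: countable unions of closed sets. -/
def IsFSigma {X : Type*} [TopologicalSpace X] (s : Set X) : Prop :=
  ∃ F : ℕ → Set X, (∀ n, IsClosed (F n)) ∧ s = ⋃ n, F n

/-- `Q`-set (for separable metrizable `X`): every subset is a `G_δ`-set. -/
def IsQSet (X : Type*) [TopologicalSpace X] : Prop :=
  ∀ s : Set X, IsGδ s

/-- `σ`-set (for separable metrizable `X`): every `F_σ`-subset is a `G_δ`-set. -/
def IsSigmaSet (X : Type*) [TopologicalSpace X] : Prop :=
  ∀ s : Set X, IsFSigma s → IsGδ s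

/-- `λ`-set (for separable metrizable `X`): every countable subset is a `G_δ`-set. -/
def IsLambdaSet (X : Type*) [TopologicalSpace X] : Prop :=
  ∀ s : Set X, s.Countable → IsGδ s

/-- `κ`-set (for separable metrizable `X`): every pairwise disjoint sequence of finite sets has a
subsequence whose union is a `G_δ`-set. -/
def IsKappaSet (X : Type*) [TopologicalSpace X] : Prop :=
  ∀ M : ℕ → Set X, (∀ n, (M n).Finite) → Pairwise (fun i j => Disjoint (M i) (M j)) →
    ∃ A : Set ℕ, A.Infinite ∧ IsGδ (⋃ n ∈ A, M n)

namespace ChoquetGame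

/-- A strategy of the second player (`Nonempty`) in the Choquet game on `Y`: a reply `V n` to each
finite sequence `U 0, …, U n` of moves of the first player (`Empty`). -/
abbrev Strategy (Y : Type*) [TopologicalSpace Y] : Type _ :=
  ∀ n : ℕ, (Fin (n + 1) → Opens Y) → Opens Y

/-- The `n`-th reply `V n` of the strategy `σ` when the first player plays `U 0, U 1, …`. -/
def Strategy.reply {Y : Type*} [TopologicalSpace Y] (σ : Strategy Y) (U : ℕ → Opens Y)
    (n : ℕ) : Opens Y :=
  σ n (fun i => U i)

/-- The moves `U 0, …, U n` of the first player are legal against `σ`: they are nonempty open sets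
and each `U (k + 1)` is contained in the preceding reply `V k`. -/
def Strategy.LegalUpTo {Y : Type*} [TopologicalSpace Y] (σ : Strategy Y) (U : ℕ → Opens Y)
    (n : ℕ) : Prop :=
  (∀ k ≤ n, (U k : Set Y).Nonempty) ∧ ∀ k < n, U (k + 1) ≤ σ.reply U k

/-- `σ` is winning for the second player: against legal moves it always answers legally, with a
nonempty open `V n ⊆ U n`, and in every infinite play that follows it `⋂ n, V n` is nonempty. -/
def Strategy.IsWinning {Y : Type*} [TopologicalSpace Y] (σ : Strategy Y) : Prop :=
  ∀ U : ℕ → Opens Y,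
    (∀ n, σ.LegalUpTo U n → (σ.reply U n : Set Y).Nonempty ∧ σ.reply U n ≤ U n) ∧
    ((∀ n, σ.LegalUpTo U n) → (⋂ n, (σ.reply U n : Set Y)).Nonempty)

end ChoquetGame

/-- A Choquet space: the second player has a winning strategy in the Choquet game. -/
def IsChoquetSpace (Y : Type*) [TopologicalSpace Y] : Prop :=
  ∃ σ : ChoquetGame.Strategy Y, σ.IsWinning

/-! ### Baire-one functions and Borel sets of low class -/

section BaireOneCriteria

variable {X : Type*} [TopologicalSpace X]

/-! Two facts drive all the equivalences. By Lebesgue–Hausdorff, Baire-one functions are those whose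
strict sub- and superlevel sets are `F_σ`. By finite interpolation, `B₁(X)` is dense in `ℝ^X`, and a
nonempty open subset of it contains every Baire-one function agreeing with a given one on some
finite set.

Countability of `X` comes from first countability at `0`; completeness means closedness, hence
equality with `ℝ^X`; sequential completeness is tested on indicators of increasing closed sets.

For Baire and Choquet, a Baire-one function tending to infinity along finite sets `M n` makes their
union `G_δ` (`isGδ_biUnion_of_le_baireOne`). Such a function is produced by genericity in the Baire
case, and by two interleaved plays against the winning strategy in the Choquet case. Conversely, any
function supported on a countable `G_δ`-set is Baire-one (`mem_baireOne_of_countable_support`). A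
winning reply pins values on finite sets, and their limit on the countable union extends by zero.
For `κ`-sets only infinitely many of the finite sets can be kept, so `exists_perturbation` makes
each stage succeed whichever earlier points are kept. -/

theorem isFSigma_iff_isGδ_compl {s : Set X} : IsFSigma s ↔ IsGδ sᶜ := by
  rw [isGδ_iff_eq_iInter_nat]
  constructor
  · rintro ⟨F, hF, rfl⟩
    exact ⟨fun n => (F n)ᶜ, fun n => (hF n).isOpen_compl, by simp⟩
  · rintro ⟨U, hU, h⟩
    refine ⟨fun n => (U n)ᶜ, fun n => (hU n).isClosed_compl, ?_⟩
    rw [← Set.compl_iInter, ← h, compl_compl]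

theorem IsFSigma.isGδ_compl {s : Set X} (h : IsFSigma s) : IsGδ sᶜ :=
  isFSigma_iff_isGδ_compl.1 h

theorem IsGδ.isFSigma_compl {s : Set X} (h : IsGδ s) : IsFSigma sᶜ := by
  rwa [isFSigma_iff_isGδ_compl, compl_compl]

theorem IsFSigma.iUnion {ι : Type*} [Countable ι] {s : ι → Set X} (h : ∀ i, IsFSigma (s i)) :
    IsFSigma (⋃ i, s i) := by
  rw [isFSigma_iff_isGδ_compl, Set.compl_iUnion]
  exact .iInter fun i => (h i).isGδ_compl

theorem IsFSigma.inter {s t : Set X} (hs : IsFSigma s) (ht : IsFSigma t) : IsFSigma (s ∩ t) := by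
  rw [isFSigma_iff_isGδ_compl, Set.compl_inter]
  exact hs.isGδ_compl.union ht.isGδ_compl

theorem continuous_mem_baireOne (φ : C(X, ℝ)) : ⇑φ ∈ baireOne X :=
  ⟨fun _ => φ, fun _ => tendsto_const_nhds⟩

/-- Uniform limits of Baire-one functions are Baire-one. -/
theorem mem_baireOne_of_forall_dist_le {f : X → ℝ}
    (h : ∀ ε > 0, ∃ g ∈ baireOne X, ∀ x, |f x - g x| ≤ ε) : f ∈ baireOne X := by
  choose g hg hfg using fun k : ℕ => h ((1 / 2) ^ k) (by positivity)
  have hb : ∀ k x, |g (k + 1) x - g k x| ≤ 2 * (1 / 2) ^ k := by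
    intro k x
    have h1 := abs_le.1 (hfg k x)
    have h2 := abs_le.1 (hfg (k + 1) x)
    have h3 : (0 : ℝ) < (1 / 2) ^ k := by positivity
    rw [pow_succ] at h2
    rw [abs_le]
    constructor <;> linarith
  have hsummable : Summable fun k : ℕ => 2 * (1 / 2 : ℝ) ^ k := summable_geometric_two.mul_left 2
  choose v hv using fun k => (baireOne X).sub_mem (hg (k + 1)) (hg k)
  obtain ⟨v₀, hv₀⟩ := hg 0
  -- Clipping the approximants of `g (k + 1) - g k` at a bound this difference obeys keeps their
  -- limit, while making the series uniformly summable and dominated.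
  have hcont : ∀ k n, Continuous fun x =>
      max (-(2 * (1 / 2 : ℝ) ^ k)) (min (2 * (1 / 2) ^ k) (v k n x)) := by
    intro k n
    fun_prop
  have hbound : ∀ k (t : ℝ),
      ‖max (-(2 * (1 / 2 : ℝ) ^ k)) (min (2 * (1 / 2) ^ k) t)‖ ≤ 2 * (1 / 2) ^ k := by
    intro k t
    have h3 : (0 : ℝ) < 2 * (1 / 2) ^ k := by positivity
    rw [Real.norm_eq_abs, abs_le]
    exact ⟨le_max_left _ _, max_le (by linarith) (min_le_left _ _)⟩
  refine ⟨fun n => v₀ n + ⟨fun x => ∑' k : ℕ, max (-(2 * (1 / 2 : ℝ) ^ k))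
    (min (2 * (1 / 2) ^ k) (v k n x)), continuous_tsum (fun k => hcont k n) hsummable
      fun k x => hbound k _⟩, fun x => ?_⟩
  have hlim : Tendsto (fun n => ∑' k : ℕ, max (-(2 * (1 / 2 : ℝ) ^ k))
      (min (2 * (1 / 2) ^ k) (v k n x))) atTop (𝓝 (∑' k, (g (k + 1) x - g k x))) := by
    refine tendsto_tsum_of_dominated_convergence hsummable (fun k => ?_)
      (Eventually.of_forall fun n k => hbound k _)
    have h1 := abs_le.1 (hb k x)
    have h2 := (tendsto_const_nhds (x := -(2 * (1 / 2 : ℝ) ^ k))).max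
      ((tendsto_const_nhds (x := 2 * (1 / 2 : ℝ) ^ k)).min (hv k x))
    rwa [Pi.sub_apply, min_eq_right h1.2, max_eq_right h1.1] at h2
  have htsum : ∑' k, (g (k + 1) x - g k x) = f x - g 0 x := by
    have hs : Summable fun k => g (k + 1) x - g k x :=
      hsummable.of_norm_bounded fun k => hb k x
    refine tendsto_nhds_unique hs.hasSum.tendsto_sum_nat ?_
    simp_rw [Finset.sum_range_sub (fun k => g k x)]
    refine Tendsto.sub_const ?_ _
    rw [tendsto_iff_dist_tendsto_zero]
    refine squeeze_zero (fun _ => dist_nonneg) (fun k => ?_)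
      (tendsto_pow_atTop_nhds_zero_of_lt_one (r := (1 / 2 : ℝ)) (by norm_num) (by norm_num))
    rw [dist_comm, Real.dist_eq]
    exact hfg k x
  have := (hv₀ x).add hlim
  rw [htsum, add_sub_cancel] at this
  exact this

/-- On a countable cover by closed sets one can choose a Baire-one function which at each point
takes the value assigned to some piece containing the point. -/
theorem exists_mem_baireOne_of_iUnion_isClosed [MetrizableSpace X] {ι : Type*} [Countable ι]
    {E : ι → Set X} (hE : ∀ i, IsClosed (E i)) (hcov : ∀ x, ∃ i, x ∈ E i) (c : ι → ℝ) :
    ∃ g ∈ baireOne X, ∀ x, ∃ i, x ∈ E i ∧ g x = c i := by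
  classical
  rcases isEmpty_or_nonempty ι with hι | hι
  · exact ⟨0, zero_mem _, fun x => (hι.false (hcov x).choose).elim⟩
  obtain ⟨e, he⟩ := exists_surjective_nat ι
  have hcov' : ∀ x, ∃ n, x ∈ E (e n) := fun x => by
    obtain ⟨i, hi⟩ := hcov x
    obtain ⟨n, rfl⟩ := he i
    exact ⟨n, hi⟩
  let _ := metrizableSpaceMetric X
  -- The first index turns the cover into a partition whose pieces are both `F_σ` and `G_δ`.
  set m : X → ℕ := fun x => Nat.find (hcov' x) with hm
  have hD : ∀ k, IsFSigma {x | m x = k} := by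
    intro k
    have : {x | m x = k} = ((E (e k))ᶜ ∪ ⋃ l ∈ Set.Iio k, E (e l))ᶜ := by
      ext x
      simp [hm, Nat.find_eq_iff]
    rw [this]
    refine IsGδ.isFSigma_compl ((hE _).isOpen_compl.isGδ.union ?_)
    exact .biUnion (Set.finite_Iio k) fun l _ => (hE _).isGδ
  choose H hH hHD using hD
  have hK : ∀ k n, IsClosed (⋃ i ∈ Set.Iic n, H k i) := fun k n =>
    (Set.finite_Iic n).isClosed_biUnion fun i _ => hH k i
  have hKm : ∀ k n, ∀ x ∈ ⋃ i ∈ Set.Iic n, H k i, m x = k := by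
    intro k n x hx
    obtain ⟨i, -, hi⟩ := Set.mem_iUnion₂.1 hx
    have : x ∈ {x | m x = k} := by rw [hHD k]; exact Set.mem_iUnion.2 ⟨i, hi⟩
    exact this
  -- Finitely many disjoint closed pieces: the function is locally constant on their union, and
  -- Tietze extends it. Each `x` eventually lies in these unions, so the extensions are eventually
  -- exact there.
  have hcont : ∀ n, ContinuousOn (fun x => c (e (m x)))
      (⋃ k : Fin (n + 1), ⋃ i ∈ Set.Iic n, H k i) := fun n =>
    (locallyFinite_of_finite _).continuousOn_iUnion (fun k => hK k n) fun k =>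
      (continuousOn_const (c := c (e k))).congr fun x hx => by rw [hKm k n x hx]
  choose u hu using fun n => ContinuousMap.exists_restrict_eq
    (isClosed_iUnion_of_finite fun k : Fin (n + 1) => hK k n)
    ⟨_, continuousOn_iff_continuous_domRestrict.1 (hcont n)⟩
  refine ⟨fun x => c (e (m x)), ⟨u, fun x => ?_⟩, fun x => ⟨e (m x), Nat.find_spec (hcov' x), rfl⟩⟩
  have hx : x ∈ ⋃ i, H (m x) i := by rw [← hHD]; rfl
  obtain ⟨i, hi⟩ := Set.mem_iUnion.1 hx
  refine tendsto_const_nhds.congr' ?_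
  filter_upwards [eventually_ge_atTop (max (m x) i)] with n hn
  have hmem : x ∈ ⋃ k : Fin (n + 1), ⋃ i ∈ Set.Iic n, H k i := by
    refine Set.mem_iUnion.2 ⟨⟨m x, by have := le_max_left (m x) i; omega⟩, ?_⟩
    exact Set.mem_iUnion₂.2 ⟨i, (le_max_right _ _).trans hn, hi⟩
  exact (DFunLike.congr_fun (hu n) ⟨x, hmem⟩).symm

/-- **Lebesgue–Hausdorff theorem**: a function whose strict sub- and superlevel sets are `F_σ` is
Baire-one. -/
theorem mem_baireOne_of_isFSigma [MetrizableSpace X] {f : X → ℝ}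
    (hlt : ∀ a, IsFSigma {x | f x < a}) (hgt : ∀ a, IsFSigma {x | a < f x}) : f ∈ baireOne X := by
  refine mem_baireOne_of_forall_dist_le fun ε hε => ?_
  have h : ∀ j : ℤ, IsFSigma ({x | (j - 1) * ε < f x} ∩ {x | f x < (j + 1) * ε}) :=
    fun j => (hgt _).inter (hlt _)
  choose F hF hFj using h
  obtain ⟨g, hg, hg'⟩ := exists_mem_baireOne_of_iUnion_isClosed (E := fun p : ℤ × ℕ => F p.1 p.2)
    (fun p => hF _ _) (fun x => by
      have hx : x ∈ ⋃ i, F ⌊f x / ε⌋ i := by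
        rw [← hFj]
        have h1 := Int.floor_le (f x / ε)
        have h2 := Int.lt_floor_add_one (f x / ε)
        rw [le_div_iff₀ hε] at h1
        rw [div_lt_iff₀ hε] at h2
        exact ⟨by simp only [Set.mem_ofPred_eq]; linarith, h2⟩
      obtain ⟨i, hi⟩ := Set.mem_iUnion.1 hx
      exact ⟨(_, i), hi⟩) (fun p => p.1 * ε)
  refine ⟨g, hg, fun x => ?_⟩
  obtain ⟨⟨j, i⟩, hx, hgx⟩ := hg' x
  have hx' : x ∈ ⋃ i, F j i := Set.mem_iUnion.2 ⟨i, hx⟩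
  rw [← hFj] at hx'
  have h1 : (j - 1) * ε < f x := hx'.1
  have h2 : f x < (j + 1) * ε := hx'.2
  rw [hgx, abs_le]
  constructor <;> simp only <;> linarith

/-- A pointwise limit `f` of a sequence `u` has `F_σ` superlevel sets as soon as the sets
`{x | ∀ n ≥ N, a ≤ u n x}` are `F_σ`. -/
theorem isFSigma_setOf_lt_of_tendsto {u : ℕ → X → ℝ} {f : X → ℝ}
    (hu : ∀ x, Tendsto (fun n => u n x) atTop (𝓝 (f x)))
    (h : ∀ a N, IsFSigma {x | ∀ n ≥ N, a ≤ u n x}) (a : ℝ) : IsFSigma {x | a < f x} := by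
  have : {x | a < f x} = ⋃ p : ℕ × ℕ, {x | ∀ n ≥ p.2, a + 1 / ((p.1 : ℝ) + 1) ≤ u n x} := by
    ext x
    simp only [Set.mem_ofPred_eq, Set.mem_iUnion, Prod.exists]
    constructor
    · intro hx
      obtain ⟨k, hk⟩ := exists_nat_one_div_lt (sub_pos.2 hx)
      have := (hu x).eventually (lt_mem_nhds (show a + 1 / ((k : ℝ) + 1) < f x by linarith))
      obtain ⟨N, hN⟩ := eventually_atTop.1 this
      exact ⟨k, N, fun n hn => (hN n hn).le⟩
    · rintro ⟨k, N, hN⟩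
      have h1 : a + 1 / ((k : ℝ) + 1) ≤ f x :=
        ge_of_tendsto (hu x) (eventually_atTop.2 ⟨N, hN⟩)
      have h2 : 0 < 1 / ((k : ℝ) + 1) := by positivity
      linarith
  rw [this]
  exact .iUnion fun p => h _ _

theorem IsClosed.isFSigma {s : Set X} (h : IsClosed s) : IsFSigma s :=
  isFSigma_iff_isGδ_compl.2 h.isOpen_compl.isGδ

theorem isFSigma_setOf_lt_of_mem_baireOne {f : X → ℝ} (hf : f ∈ baireOne X) (a : ℝ) :
    IsFSigma {x | a < f x} := by
  obtain ⟨u, hu⟩ := hf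
  refine isFSigma_setOf_lt_of_tendsto hu (fun a N => ?_) a
  simp only [Set.ofPred_forall]
  exact (isClosed_iInter fun n => isClosed_iInter fun _ =>
    isClosed_le continuous_const (u n).continuous).isFSigma

theorem isGδ_setOf_ge_of_mem_baireOne {f : X → ℝ} (hf : f ∈ baireOne X) (a : ℝ) :
    IsGδ {x | a ≤ f x} := by
  have h := (isFSigma_setOf_lt_of_mem_baireOne ((baireOne X).neg_mem hf) (-a)).isGδ_compl
  convert h using 1
  ext x
  simp

/-- Functions supported on a countable `G_δ`-set are Baire-one. -/
theorem mem_baireOne_of_countable_support [MetrizableSpace X] {D : Set X} (hD : D.Countable)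
    (hG : IsGδ D) {f : X → ℝ} (hf : ∀ x ∉ D, f x = 0) : f ∈ baireOne X := by
  obtain ⟨F, hF, hFD⟩ := hG.isFSigma_compl
  have := hD.to_subtype
  obtain ⟨g, hg, hgx⟩ := exists_mem_baireOne_of_iUnion_isClosed
    (E := Sum.elim (fun d : D => {(d : X)}) F) (by rintro (d | n); exacts [isClosed_singleton, hF n])
    (fun x => by
      by_cases hx : x ∈ D
      · exact ⟨.inl ⟨x, hx⟩, rfl⟩
      · obtain ⟨n, hn⟩ := Set.mem_iUnion.1 (hFD ▸ hx : x ∈ ⋃ n, F n)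
        exact ⟨.inr n, hn⟩)
    (Sum.elim (fun d : D => f d) fun _ => 0)
  convert hg
  ext x
  obtain ⟨d | n, hx, h⟩ := hgx x
  · rw [h]
    exact congrArg f hx
  · rw [h]
    refine hf x ?_
    change x ∈ Dᶜ
    rw [hFD]
    exact Set.mem_iUnion.2 ⟨n, hx⟩

theorem Set.Countable.isGδ_of_subset [T1Space X] {C D : Set X} (hD : D.Countable) (hG : IsGδ D)
    (hCD : C ⊆ D) : IsGδ C := by
  have h : C = D ∩ (D \ C)ᶜ := by
    ext x
    simp only [Set.mem_inter_iff, Set.mem_compl_iff, Set.mem_sdiff, not_and, not_not]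
    exact ⟨fun h => ⟨hCD h, fun _ => h⟩, fun h => h.2 h.1⟩
  rw [h]
  exact hG.inter (hD.mono Set.sdiff_subset).isGδ_compl

/-- A sequence of finite sets on which a Baire-one function tends to infinity has a `G_δ` union. -/
theorem isGδ_biUnion_of_le_baireOne [MetrizableSpace X] {f : X → ℝ} (hf : f ∈ baireOne X)
    {M : ℕ → Set X} (hM : ∀ n, (M n).Finite) {A : Set ℕ} (h : ∀ n ∈ A, ∀ x ∈ M n, (n : ℝ) ≤ f x) :
    IsGδ (⋃ n ∈ A, M n) := by
  let _ := metrizableSpaceMetric X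
  -- Taking `k > f x` excludes the second alternative and forces `x` into one of the early `M n`.
  have key : ⋃ n ∈ A, M n = ⋂ k : ℕ, ((⋃ n ∈ Set.Iio k ∩ A, M n) ∪ {x | (k : ℝ) ≤ f x}) := by
    ext x
    simp only [Set.mem_iUnion, Set.mem_iInter, Set.mem_union, Set.mem_ofPred_eq, exists_prop,
      Set.mem_inter_iff, Set.mem_Iio]
    constructor
    · rintro ⟨n, hn, hx⟩ k
      by_cases hk : n < k
      · exact .inl ⟨n, ⟨hk, hn⟩, hx⟩
      · exact .inr (le_trans (by exact_mod_cast not_lt.1 hk) (h n hn x hx))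
    · intro hx
      obtain ⟨k, hk⟩ := exists_nat_gt (f x)
      rcases hx k with ⟨n, hn, hxn⟩ | hk'
      · exact ⟨n, hn.2, hxn⟩
      · exact absurd hk' (not_le.2 hk)
  rw [key]
  refine .iInter fun k => .union ?_ (isGδ_setOf_ge_of_mem_baireOne hf _)
  exact (((Set.finite_Iio k).inter_of_left A).biUnion fun n _ => hM n).isClosed.isGδ

end BaireOneCriteria

/-! ### Basic neighbourhoods for pointwise convergence -/

section Neighbourhoods

/-- Basic neighbourhoods in the topology of pointwise convergence. -/
theorem IsOpen.exists_finset_forall_abs_sub_le {X : Type*} {V : Set (X → ℝ)} (hV : IsOpen V) {g : X → ℝ}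
    (hg : g ∈ V) : ∃ (I : Finset X) (δ : ℝ), 0 < δ ∧
      ∀ f : X → ℝ, (∀ x ∈ I, |f x - g x| ≤ δ) → f ∈ V := by
  obtain ⟨I, u, hu, huV⟩ := isOpen_pi_iff.1 hV g hg
  have h : ∀ᶠ δ in 𝓝[>] (0 : ℝ), ∀ x ∈ I, Metric.closedBall (g x) δ ⊆ u x := by
    rw [Finset.eventually_all]
    intro x hx
    obtain ⟨ε, hε, hball⟩ := Metric.isOpen_iff.1 (hu x hx).1 _ (hu x hx).2
    filter_upwards [Ioo_mem_nhdsGT hε] with δ hδ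
    exact (Metric.closedBall_subset_ball hδ.2).trans hball
  obtain ⟨δ, hδ, hδ0⟩ := (h.and self_mem_nhdsWithin).exists
  exact ⟨I, δ, hδ0, fun f hf => huV fun x hx => hδ x hx (by
    rw [Metric.mem_closedBall, Real.dist_eq]; exact hf x hx)⟩

/-- Basic neighbourhoods in the space of Baire-one functions. -/
theorem IsOpen.exists_finset_forall_baireOne {X : Type*} [TopologicalSpace X] {V : Set (baireOne X)} (hV : IsOpen V)
    {g : baireOne X} (hg : g ∈ V) : ∃ (I : Finset X) (δ : ℝ), 0 < δ ∧
      ∀ f : baireOne X, (∀ x ∈ I, |(f : X → ℝ) x - (g : X → ℝ) x| ≤ δ) → f ∈ V := by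
  obtain ⟨W, hW, rfl⟩ := isOpen_induced_iff.1 hV
  obtain ⟨I, δ, hδ, h⟩ := hW.exists_finset_forall_abs_sub_le (g := g) hg
  exact ⟨I, δ, hδ, fun f hf => h f hf⟩

end Neighbourhoods

/-! ### Interpolation on finite sets and density -/

section Interpolation

variable {X : Type*} [TopologicalSpace X] [MetrizableSpace X]

theorem exists_continuousMap_eqOn_finset (F : Finset X) (h : X → ℝ) :
    ∃ φ : C(X, ℝ), ∀ x ∈ F, φ x = h x := by
  let _ := metrizableSpaceMetric X
  obtain ⟨φ, hφ⟩ := ContinuousMap.exists_restrict_eq F.finite_toSet.isClosed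
    ⟨fun x : (F : Set X) => h x, continuous_of_discreteTopology⟩
  exact ⟨φ, fun x hx => DFunLike.congr_fun hφ ⟨x, hx⟩⟩

theorem exists_continuousMap_eqOn_finset_of_abs_le (F : Finset X) (h : X → ℝ) {ε : ℝ} (hε : 0 ≤ ε)
    (hh : ∀ x ∈ F, |h x| ≤ ε) : ∃ φ : C(X, ℝ), (∀ x ∈ F, φ x = h x) ∧ ∀ x, |φ x| ≤ ε := by
  obtain ⟨φ, hφ⟩ := exists_continuousMap_eqOn_finset F h
  refine ⟨⟨fun x => max (-ε) (min ε (φ x)), by fun_prop⟩, fun x hx => ?_, fun x => ?_⟩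
  · have := abs_le.1 (hh x hx)
    simp [hφ x hx, this.1, this.2]
  · rw [abs_le]
    exact ⟨le_max_left _ _, max_le (by linarith) (min_le_left _ _)⟩

theorem exists_baireOne_eqOn_finset (F : Finset X) (h : X → ℝ) :
    ∃ f : baireOne X, ∀ x ∈ F, (f : X → ℝ) x = h x := by
  obtain ⟨φ, hφ⟩ := exists_continuousMap_eqOn_finset F h
  exact ⟨⟨φ, continuous_mem_baireOne φ⟩, hφ⟩

theorem dense_baireOne : Dense (baireOne X : Set (X → ℝ)) := by
  intro g
  rw [mem_closure_iff]
  intro V hV hg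
  obtain ⟨I, δ, hδ, h⟩ := hV.exists_finset_forall_abs_sub_le hg
  obtain ⟨f, hf⟩ := exists_baireOne_eqOn_finset I g
  exact ⟨f, h f fun x hx => by simp [hf x hx, hδ.le], f.2⟩

end Interpolation

theorem IsSigmaSet.isFSigma_of_isGδ {X : Type*} [TopologicalSpace X] (h : IsSigmaSet X) {s : Set X} (hs : IsGδ s) : IsFSigma s :=
  isFSigma_iff_isGδ_compl.2 (h _ hs.isFSigma_compl)

/-! ### Polishness, completeness and sequential completeness -/

section Completeness

variable {X : Type*} [TopologicalSpace X] [MetrizableSpace X]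

theorem baireOne_eq_top_iff_isQSet : baireOne X = ⊤ ↔ IsQSet X := by
  constructor
  · intro h s
    have hs : s.indicator (fun _ => (1 : ℝ)) ∈ baireOne X := h ▸ Submodule.mem_top
    convert isGδ_setOf_ge_of_mem_baireOne hs 1 using 1
    ext x
    by_cases hx : x ∈ s <;> simp [hx]
  · intro h
    have hF : ∀ s : Set X, IsFSigma s := fun s => isFSigma_iff_isGδ_compl.2 (h _)
    exact eq_top_iff.2 fun f _ => mem_baireOne_of_isFSigma (fun _ => hF _) fun _ => hF _

theorem completeSpace_baireOne_iff : CompleteSpace (baireOne X) ↔ baireOne X = ⊤ := by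
  constructor
  · intro h
    have hc : IsClosed (baireOne X : Set (X → ℝ)) :=
      (completeSpace_coe_iff_isComplete.1 h).isClosed
    rw [← SetLike.coe_set_eq, Submodule.top_coe, ← hc.closure_eq]
    exact dense_baireOne.closure_eq
  · intro h
    have hc : IsClosed (baireOne X : Set (X → ℝ)) := by simp [h]
    exact completeSpace_coe_iff_isComplete.2 hc.isComplete

/-- A countable base at `0` controls only countably many coordinates, and any other coordinate could
be changed freely. Conversely, in a countable `X` all subsets are `F_σ`, so `B₁(X)` is a countable
power of `ℝ`. -/
theorem polishSpace_baireOne_iff : PolishSpace (baireOne X) ↔ Countable X := by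
  constructor
  · intro h
    obtain ⟨B, hB⟩ := (𝓝 (0 : baireOne X)).exists_antitone_basis
    have hbox : ∀ n, ∃ I : Finset X, ∀ f : baireOne X, (∀ x ∈ I, (f : X → ℝ) x = 0) → f ∈ B n := by
      intro n
      obtain ⟨V, hVB, hV, h0⟩ := mem_nhds_iff.1 (hB.mem n)
      obtain ⟨I, δ, hδ, hI⟩ := hV.exists_finset_forall_baireOne h0
      exact ⟨I, fun f hf => hVB (hI f fun x hx => by simp [hf x hx, hδ.le])⟩
    choose I hI using hbox
    have hc : (⋃ n, (I n : Set X)).Countable := Set.countable_iUnion fun n => (I n).countable_toSet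
    rw [← Set.countable_univ_iff]
    refine hc.mono fun x _ => ?_
    by_contra hx
    simp only [Set.mem_iUnion, not_exists] at hx
    have hopen : IsOpen {f : baireOne X | (f : X → ℝ) x < 1} :=
      isOpen_lt ((continuous_apply x).comp continuous_subtype_val) continuous_const
    obtain ⟨n, hn⟩ := hB.mem_iff.1 (hopen.mem_nhds (show (0 : baireOne X) ∈ _ by simp))
    classical
    obtain ⟨f, hf⟩ := exists_baireOne_eqOn_finset (insert x (I n)) fun y => if y = x then 1 else 0
    have h1 : (f : X → ℝ) x < 1 := hn (hI n f fun y hy => by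
      rw [hf y (Finset.mem_insert_of_mem hy), if_neg]
      rintro rfl
      exact hx n hy)
    rw [hf x (Finset.mem_insert_self _ _), if_pos rfl] at h1
    exact lt_irrefl _ h1
  · intro h
    have htop : baireOne X = ⊤ := baireOne_eq_top_iff_isQSet.2 fun s => by
      have hs : IsFSigma sᶜ := by
        rw [← Set.biUnion_of_singleton sᶜ, Set.biUnion_eq_iUnion]
        exact .iUnion fun x => isClosed_singleton.isFSigma
      simpa using hs.isGδ_compl
    have hc : IsClosed (baireOne X : Set (X → ℝ)) := by simp [htop]
    exact hc.polishSpace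

/-- Indicators of the finite partial unions of an `F_σ`-set are Baire-one and converge to its
indicator. Conversely, in a `σ`-set `G_δ`-sets are `F_σ`, so pointwise limits gain no Borel
complexity. -/
theorem isSequentiallyComplete_baireOne_iff :
    IsSequentiallyComplete (baireOne X) ↔ IsSigmaSet X := by
  constructor
  · rintro h s ⟨F, hF, rfl⟩
    have hmem : ∀ n, (⋃ i ∈ Set.Iic n, F i).indicator (fun _ => (1 : ℝ)) ∈ baireOne X := by
      intro n
      have hc : IsClosed (⋃ i ∈ Set.Iic n, F i) :=
        (Set.finite_Iic n).isClosed_biUnion fun i _ => hF i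
      let _ := metrizableSpaceMetric X
      obtain ⟨G, hG, hGF⟩ := hc.isGδ.isFSigma_compl
      obtain ⟨g, hg, hgx⟩ := exists_mem_baireOne_of_iUnion_isClosed
        (E := fun o : Option ℕ => o.elim (⋃ i ∈ Set.Iic n, F i) G)
        (by rintro (_ | k); exacts [hc, hG k])
        (fun x => by
          by_cases hx : x ∈ ⋃ i ∈ Set.Iic n, F i
          · exact ⟨none, hx⟩
          · obtain ⟨k, hk⟩ := Set.mem_iUnion.1 (hGF ▸ hx : x ∈ ⋃ n, G n)
            exact ⟨some k, hk⟩)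
        (fun o => o.elim 1 fun _ => 0)
      convert hg
      ext x
      obtain ⟨_ | k, hx, hgx⟩ := hgx x
      · exact (Set.indicator_of_mem hx _).trans hgx.symm
      · refine (Set.indicator_of_notMem ?_ _).trans hgx.symm
        change x ∈ (⋃ i ∈ Set.Iic n, F i)ᶜ
        rw [hGF]
        exact Set.mem_iUnion.2 ⟨k, hx⟩
    have hlim : Tendsto (fun n => (⋃ i ∈ Set.Iic n, F i).indicator (fun _ => (1 : ℝ))) atTop
        (𝓝 ((⋃ i, F i).indicator fun _ => 1)) := by
      refine tendsto_pi_nhds.2 fun x => tendsto_const_nhds.congr' ?_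
      by_cases hx : x ∈ ⋃ i, F i
      · obtain ⟨i, hi⟩ := Set.mem_iUnion.1 hx
        filter_upwards [eventually_ge_atTop i] with n hn
        rw [Set.indicator_of_mem hx, Set.indicator_of_mem]
        exact Set.mem_iUnion₂.2 ⟨i, hn, hi⟩
      · refine Eventually.of_forall fun n => ?_
        rw [Set.indicator_of_notMem hx]
        refine (Set.indicator_of_notMem ?_ _).symm
        exact fun hx' => hx (Set.iUnion₂_subset_iUnion _ _ hx')
    obtain ⟨a, ha⟩ := h (fun n => ⟨_, hmem n⟩)
      ((isUniformInducing_val _).cauchy_map_iff.1 hlim.cauchySeq)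
    have haeq : (a : X → ℝ) = (⋃ i, F i).indicator fun _ => 1 :=
      tendsto_nhds_unique ((continuous_subtype_val.tendsto a).comp ha) hlim
    convert isGδ_setOf_ge_of_mem_baireOne a.2 1 using 1
    ext x
    rw [haeq]
    by_cases hx : x ∈ ⋃ i, F i <;> simp [hx]
  · intro h u hu
    have hgt : ∀ (v : ℕ → X → ℝ) (f : X → ℝ), (∀ n, v n ∈ baireOne X) →
        (∀ x, Tendsto (fun n => v n x) atTop (𝓝 (f x))) → ∀ a, IsFSigma {x | a < f x} := by
      intro v f hv hvf
      refine isFSigma_setOf_lt_of_tendsto hvf fun a N => h.isFSigma_of_isGδ ?_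
      simp only [Set.ofPred_forall]
      exact .iInter fun n => .iInter fun _ => isGδ_setOf_ge_of_mem_baireOne (hv n) a
    obtain ⟨f, hf⟩ := cauchySeq_tendsto_of_complete
      (u := fun n => (u n : X → ℝ)) (uniformContinuous_subtype_val.comp_cauchySeq hu)
    have hf' := tendsto_pi_nhds.1 hf
    have hfB : f ∈ baireOne X := by
      refine mem_baireOne_of_isFSigma (fun a => ?_) (hgt _ _ (fun n => (u n).2) hf')
      convert hgt _ _ (fun n => (baireOne X).neg_mem (u n).2) (fun x => (hf' x).neg) (-a) using 1
      ext x
      simp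
    exact ⟨⟨f, hfB⟩, tendsto_subtype_rng.2 hf⟩

end Completeness

theorem exists_uniform_limit {X : Type*} [TopologicalSpace X] {φ : ℕ → C(X, ℝ)} {δ : ℕ → ℝ} (hδ : ∀ n, 0 < δ n)
    (hδ2 : ∀ n, δ (n + 1) ≤ δ n / 2) (hφ : ∀ n x, |φ (n + 1) x - φ n x| ≤ δ n / 2) :
    ∃ ψ : C(X, ℝ), ∀ n x, |ψ x - φ n x| ≤ δ n := by
  -- Halving gives `δ n / 2 ≤ δ n - δ (n + 1)`, so the bounds telescope.
  have hle : ∀ n k x, |φ (n + k) x - φ n x| ≤ δ n - δ (n + k) := by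
    intro n k x
    induction k with
    | zero => simp
    | succ k ih =>
      have h1 := hδ2 (n + k)
      have h2 := hφ (n + k) x
      have h3 := abs_sub_le (φ (n + k + 1) x) (φ (n + k) x) (φ n x)
      rw [← add_assoc]
      linarith
  have hpow : ∀ n, δ n ≤ δ 0 * (1 / 2) ^ n := by
    intro n
    induction n with
    | zero => simp
    | succ n ih =>
      have := hδ2 n
      rw [pow_succ]
      linarith
  have hδ0 : Tendsto δ atTop (𝓝 0) := by
    refine squeeze_zero (fun n => (hδ n).le) hpow ?_
    simpa using (tendsto_pow_atTop_nhds_zero_of_lt_one (r := (1 / 2 : ℝ)) (by norm_num)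
      (by norm_num)).const_mul (δ 0)
  have hle' : ∀ n m, n ≤ m → ∀ x, |φ m x - φ n x| ≤ δ n := by
    intro n m hnm x
    obtain ⟨k, rfl⟩ := Nat.exists_eq_add_of_le hnm
    have := hle n k x
    have := hδ (n + k)
    linarith
  have hlim : ∀ x, ∃ a, Tendsto (fun n => φ n x) atTop (𝓝 a) := fun x =>
    cauchySeq_tendsto_of_complete (cauchySeq_of_le_tendsto_0' δ (fun n m hnm => by
      rw [dist_comm]
      exact hle' n m hnm x) hδ0)
  choose ψ hψ using hlim
  have hψle : ∀ n x, |ψ x - φ n x| ≤ δ n := fun n x =>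
    le_of_tendsto ((hψ x).sub_const _).abs
      ((eventually_ge_atTop n).mono fun m hm => hle' n m hm x)
  have hcont : Continuous ψ := by
    have hu : TendstoUniformly (fun n x => φ n x) ψ atTop := by
      rw [Metric.tendstoUniformly_iff]
      intro ε hε
      filter_upwards [hδ0.eventually (gt_mem_nhds hε)] with n hn x
      exact (hψle n x).trans_lt hn
    exact hu.continuous (Frequently.of_forall fun n => (φ n).continuous)
  exact ⟨⟨ψ, hcont⟩, hψle⟩

/-! ### The Baire property and `κ`-sets -/

section Baire

variable {X : Type*} [TopologicalSpace X] [MetrizableSpace X]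

/-- A generic `f` exceeds `n` on `M n` for infinitely many `n`. Density holds because a finite set
of coordinates misses some late `M n`, by disjointness. -/
theorem isKappaSet_of_baireSpace_baireOne (h : BaireSpace (baireOne X)) : IsKappaSet X := by
  intro M hM hdisj
  classical
  have hopen : ∀ N, IsOpen {f : baireOne X | ∃ n ≥ N, ∀ x ∈ M n, (n : ℝ) < (f : X → ℝ) x} := by
    intro N
    simp only [Set.ofPred_exists, ← exists_prop, Set.ofPred_forall]
    refine isOpen_iUnion fun n => isOpen_iUnion fun _ => (hM n).isOpen_biInter fun x _ => ?_
    exact isOpen_lt continuous_const ((continuous_apply x).comp continuous_subtype_val)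
  have hdense : ∀ N, Dense {f : baireOne X | ∃ n ≥ N, ∀ x ∈ M n, (n : ℝ) < (f : X → ℝ) x} := by
    intro N g
    rw [mem_closure_iff]
    intro V hV hg
    obtain ⟨I, δ, hδ, hI⟩ := hV.exists_finset_forall_baireOne hg
    obtain ⟨n, hn, hnI⟩ : ∃ n ≥ N, ∀ x ∈ M n, x ∉ I := by
      by_contra! hcon
      choose y hyM hyI using fun n => hcon (N + n) (Nat.le_add_right N n)
      refine not_injective_infinite_finite
        (fun n : ℕ => (⟨y n, hyI n⟩ : I)) fun a b hab => ?_
      by_contra hne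
      have hab' : y a = y b := congrArg Subtype.val hab
      exact Set.disjoint_left.1 (hdisj (show N + a ≠ N + b by omega))
        (hyM a) (hab' ▸ hyM b)
    obtain ⟨f, hf⟩ := exists_baireOne_eqOn_finset (I ∪ (hM n).toFinset)
      fun x => if x ∈ I then (g : X → ℝ) x else n + 1
    refine ⟨f, hI f fun x hx => ?_, n, hn, fun x hx => ?_⟩
    · simp [hf x (Finset.mem_union_left _ hx), hx, hδ.le]
    · simp [hf x (Finset.mem_union_right _ ((hM n).mem_toFinset.2 hx)), hnI x hx]
  obtain ⟨f, hf⟩ := (dense_iInter_of_isOpen hopen hdense).nonempty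
  rw [Set.mem_iInter] at hf
  refine ⟨{n | ∀ x ∈ M n, (n : ℝ) < (f : X → ℝ) x}, ?_,
    isGδ_biUnion_of_le_baireOne f.2 hM fun n hn x hx => (hn x hx).le⟩
  rw [← Nat.frequently_atTop_iff_infinite, frequently_atTop]
  exact hf

theorem dense_biInter_finset_of_isOpen {Y ι : Type*} [TopologicalSpace Y] (T : Finset ι)
    {V : ι → Set Y} (hV : ∀ i, IsOpen (V i)) (hd : ∀ i, Dense (V i)) : Dense (⋂ i ∈ T, V i) := by
  classical
  induction T using Finset.induction_on with
  | empty => simp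
  | insert i T _ ih =>
    rw [Finset.set_biInter_insert]
    exact (hd i).inter_of_isOpen_left ih (hV i)

/-- One step of the construction of a Baire-one function in the intersection of dense open sets:
`u` is extended to a larger finite set and `φ` slightly perturbed so that `φ' + 1_S u'` lies in `V`
simultaneously for all `S` containing the new points. -/
theorem exists_perturbation {V : Set (X → ℝ)} (hV : IsOpen V) (hd : Dense V) (φ : C(X, ℝ))
    (u : X → ℝ) (F : Finset X) {ε : ℝ} (hε : 0 < ε) :
    ∃ (φ' : C(X, ℝ)) (u' : X → ℝ) (F' : Finset X) (δ : ℝ), 0 < δ ∧ δ ≤ ε ∧ F ⊆ F' ∧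
      (∀ x, |φ' x - φ x| ≤ ε) ∧ (∀ x ∈ F, u' x = u x) ∧
      ∀ S : Set X, (∀ x ∈ F', x ∉ F → x ∈ S) → ∀ g : X → ℝ,
        (∀ x ∈ F', |g x - (φ' x + S.indicator u' x)| ≤ δ) → g ∈ V := by
  classical
  -- There are only finitely many traces of `S` on `F`; one `h` near `φ` on `F` serves all the
  -- corresponding translates of `V`.
  set W : Finset X → Set (X → ℝ) := fun S => (fun g => g + (S : Set X).indicator u) ⁻¹' V
  have hWo : ∀ S, IsOpen (W S) := fun S => hV.preimage (by fun_prop)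
  have hWd : ∀ S, Dense (W S) := fun S =>
    hd.preimage (Homeomorph.addRight ((S : Set X).indicator u)).isOpenMap
  have hbox : IsOpen {f : X → ℝ | ∀ x ∈ F, |f x - φ x| < ε} := by
    simp only [Set.ofPred_forall]
    exact isOpen_biInter_finset fun x _ => isOpen_lt (by fun_prop) continuous_const
  obtain ⟨h, hhbox, hhW⟩ := (dense_biInter_finset_of_isOpen F.powerset hWo hWd).inter_open_nonempty
    _ hbox ⟨φ, fun x _ => by simp [hε]⟩
  obtain ⟨I, δ, hδ, hI⟩ := (isOpen_biInter_finset (s := F.powerset)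
    fun S _ => hWo S).exists_finset_forall_abs_sub_le hhW
  obtain ⟨p, hpF, hpε⟩ := exists_continuousMap_eqOn_finset_of_abs_le F (fun x => h x - φ x) hε.le
    fun x hx => (hhbox x hx).le
  -- With these choices `φ' + 1_S u'` equals `h + 1_{S ∩ F} u` on `F'`: `p` corrects `φ` to `h` on
  -- `F`, and `u'` absorbs the error at the new points.
  refine ⟨φ + p, fun x => if x ∈ F then u x else h x - φ x - p x, F ∪ I, min δ ε,
    lt_min hδ hε, min_le_right _ _, Finset.subset_union_left, fun x => ?_,
    fun x hx => if_pos hx, fun S hS g hg => ?_⟩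
  · simpa using hpε x
  · set T : Finset X := {x ∈ F | x ∈ S} with hT
    have hmem := hI (g - (T : Set X).indicator u) fun x hx => by
      refine le_trans (le_of_eq ?_) ((hg x (Finset.mem_union_right _ hx)).trans (min_le_left _ _))
      congr 1
      by_cases hxF : x ∈ F
      · by_cases hxS : x ∈ S
        · simp [hT, hxF, hxS, hpF x hxF]
          ring
        · simp [hT, hxF, hxS, hpF x hxF]
      · have hxS := hS x (Finset.mem_union_right _ hx) hxF
        simp [hT, hxF, hxS]
    have := Set.mem_iInter₂.1 hmem T (Finset.mem_powerset.2 (Finset.filter_subset _ _))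
    simpa [W] using this

/-- In a `κ`-set, each decreasing sequence of dense open subsets of `ℝ^X` has a common Baire-one
function close to any prescribed continuous function on a given finite set. -/
theorem IsKappaSet.exists_baireOne_forall_mem (h : IsKappaSet X) {V : ℕ → Set (X → ℝ)}
    (hV : ∀ n, IsOpen (V n)) (hd : ∀ n, Dense (V n)) (hanti : Antitone V) (φ₀ : C(X, ℝ))
    (F₀ : Finset X) {δ₀ : ℝ} (hδ₀ : 0 < δ₀) :
    ∃ f ∈ baireOne X, (∀ x ∈ F₀, |f x - φ₀ x| ≤ δ₀) ∧ ∀ n, f ∈ V n := by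
  classical
  choose nφ nu nF nδ hpos hle hsub hnφ hnu hnV using
    fun (n : ℕ) (s : C(X, ℝ) × (X → ℝ) × Finset X × {δ : ℝ // 0 < δ}) =>
      exists_perturbation (hV n) (hd n) s.1 s.2.1 s.2.2.1 (half_pos s.2.2.2.2)
  let s : ℕ → C(X, ℝ) × (X → ℝ) × Finset X × {δ : ℝ // 0 < δ} := fun n =>
    Nat.rec (φ₀, 0, F₀, ⟨δ₀, hδ₀⟩) (fun n s => (nφ n s, nu n s, nF n s, ⟨nδ n s, hpos n s⟩)) n
  obtain ⟨ψ, hψ⟩ := exists_uniform_limit (φ := fun n => (s n).1)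
    (δ := fun n => ((s n).2.2.2 : ℝ)) (fun n => (s n).2.2.2.2) (fun n => hle n (s n))
    fun n x => hnφ n (s n) x
  have hFmono : Monotone fun n => (s n).2.2.1 := monotone_nat_of_le_succ fun n => hsub n (s n)
  have hu : ∀ n m, n ≤ m → ∀ x ∈ (s n).2.2.1, (s m).2.1 x = (s n).2.1 x := by
    intro n m hnm x hx
    induction m, hnm using Nat.le_induction with
    | base => rfl
    | succ m hm ih => exact (hnu m (s m) x (hFmono hm hx)).trans ih
  obtain ⟨U, hU⟩ : ∃ U : X → ℝ, ∀ n, ∀ x ∈ (s n).2.2.1, U x = (s n).2.1 x := by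
    refine ⟨fun x => if hx : ∃ n, x ∈ (s n).2.2.1 then (s (Nat.find hx)).2.1 x else 0,
      fun n x hx => ?_⟩
    have hex : ∃ n, x ∈ (s n).2.2.1 := ⟨n, hx⟩
    simp only [dif_pos hex]
    exact (hu _ n (Nat.find_min' hex hx) x (Nat.find_spec hex)).symm
  -- The `κ`-property selects infinitely many batches of new points with `G_δ` union `D`. At each
  -- selected stage `D` contains the whole batch, so `ψ + 1_D U` lies in that `V m`; since `V` is
  -- decreasing, these stages suffice.
  obtain ⟨A, hA, hG⟩ := h (fun n => (((s (n + 1)).2.2.1 \ (s n).2.2.1 : Finset X) : Set X))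
    (fun n => Finset.finite_toSet _) (by
      refine (pairwise_disjoint_on _).2 fun m n hmn => ?_
      rw [Finset.disjoint_coe, Finset.disjoint_left]
      intro x hx hx'
      exact (Finset.mem_sdiff.1 hx').2 (hFmono hmn (Finset.mem_sdiff.1 hx).1))
  set D := ⋃ n ∈ A, (((s (n + 1)).2.2.1 \ (s n).2.2.1 : Finset X) : Set X) with hD
  have hDc : D.Countable := A.to_countable.biUnion fun n _ => Finset.countable_toSet _
  have hind : D.indicator U ∈ baireOne X :=
    mem_baireOne_of_countable_support hDc hG fun x hx => Set.indicator_of_notMem hx _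
  refine ⟨ψ + D.indicator U, (baireOne X).add_mem (continuous_mem_baireOne ψ) hind,
    fun x hx => ?_, fun n => ?_⟩
  · have hxD : x ∉ D := by
      intro hxD
      obtain ⟨n, -, hn⟩ := Set.mem_iUnion₂.1 hxD
      exact (Finset.mem_sdiff.1 hn).2 (hFmono (Nat.zero_le n) hx)
    rw [Pi.add_apply, Set.indicator_of_notMem hxD, add_zero]
    exact hψ 0 x
  · obtain ⟨m, hm, hnm⟩ := hA.exists_gt n
    refine hanti hnm.le (hnV m (s m) D (fun x hx hx' => ?_) _ fun x hx => ?_)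
    · exact Set.mem_iUnion₂.2 ⟨m, hm, Finset.mem_coe.2 (Finset.mem_sdiff.2 ⟨hx, hx'⟩)⟩
    · have h1 : D.indicator U x = D.indicator (nu m (s m)) x := by
        by_cases hxD : x ∈ D
        · simp only [Set.indicator_of_mem hxD]
          exact hU (m + 1) x hx
        · simp [hxD]
      rw [Pi.add_apply, h1, add_sub_add_right_eq_sub]
      exact hψ (m + 1) x

theorem IsKappaSet.baireSpace_baireOne (h : IsKappaSet X) : BaireSpace (baireOne X) := by
  refine ⟨fun O hO hOd => ?_⟩
  choose V hV hVO using fun n => isOpen_induced_iff.1 (hO n)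
  have hVd : ∀ n, Dense (V n) := fun n => by
    refine (dense_baireOne.denseRange_val.dense_image continuous_subtype_val (hOd n)).mono ?_
    rintro _ ⟨f, hf, rfl⟩
    rw [← hVO] at hf
    exact hf
  intro g
  rw [mem_closure_iff]
  intro W hW hg
  obtain ⟨I, δ, hδ, hI⟩ := hW.exists_finset_forall_baireOne hg
  obtain ⟨φ, hφ⟩ := exists_continuousMap_eqOn_finset I (g : X → ℝ)
  obtain ⟨f, hf, hfI, hfV⟩ := h.exists_baireOne_forall_mem
    (V := fun n => ⋂ i ∈ Finset.range (n + 1), V i)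
    (fun n => isOpen_biInter_finset fun i _ => hV i)
    (fun n => dense_biInter_finset_of_isOpen _ hV hVd)
    (fun m n hmn => Set.biInter_subset_biInter_left fun i hi => by
      simp only [Finset.mem_coe, Finset.mem_range] at hi ⊢
      omega) φ I hδ
  refine ⟨⟨f, hf⟩, hI _ fun x hx => hφ x hx ▸ hfI x hx, Set.mem_iInter.2 fun n => ?_⟩
  rw [← hVO]
  exact Set.mem_iInter₂.1 (hfV n) n (Finset.self_mem_range_succ n)

theorem baireSpace_baireOne_iff : BaireSpace (baireOne X) ↔ IsKappaSet X :=
  ⟨isKappaSet_of_baireSpace_baireOne, IsKappaSet.baireSpace_baireOne⟩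

end Baire

/-! ### Positions in the Choquet game -/

namespace ChoquetGame.Strategy

variable {Y : Type*} [TopologicalSpace Y] {σ : Strategy Y}

theorem reply_congr {U U' : ℕ → Opens Y} {n : ℕ} (h : ∀ j ≤ n, U j = U' j) :
    σ.reply U n = σ.reply U' n :=
  congrArg (σ n) (funext fun i => h i (Nat.le_of_lt_succ i.2))

theorem LegalUpTo.congr {U U' : ℕ → Opens Y} {n : ℕ} (hU : σ.LegalUpTo U n)
    (h : ∀ j ≤ n, U j = U' j) : σ.LegalUpTo U' n := by
  refine ⟨fun k hk => h k hk ▸ hU.1 k hk, fun k hk => ?_⟩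
  rw [← h (k + 1) hk, ← reply_congr fun j hj => h j (hj.trans hk.le)]
  exact hU.2 k hk

theorem LegalUpTo.mono {U : ℕ → Opens Y} {m n : ℕ} (hU : σ.LegalUpTo U n) (hmn : m ≤ n) :
    σ.LegalUpTo U m :=
  ⟨fun k hk => hU.1 k (hk.trans hmn), fun k hk => hU.2 k (hk.trans_le hmn)⟩

/-- A winning strategy, seen as a tree of finite plays `p` each with its last reply `cur p`. -/
theorem IsWinning.exists_positions.{u} {Y : Type u} [TopologicalSpace Y] [Nonempty Y] {σ : Strategy Y}
    (hσ : σ.IsWinning) :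
    ∃ (P : Type u) (cur : P → Set Y) (ext : P → P → Prop), Nonempty P ∧ (∀ p, IsOpen (cur p)) ∧
      (∀ p, (cur p).Nonempty) ∧
      (∀ p O, IsOpen O → O.Nonempty → O ⊆ cur p → ∃ p', ext p p' ∧ cur p' ⊆ O) ∧
      ∀ s : ℕ → P, (∀ n, ext (s n) (s (n + 1))) → (⋂ n, cur (s n)).Nonempty := by
  -- A position stores an infinite sequence, but only its entries up to the stored index matter.
  refine ⟨{q : ℕ × (ℕ → Opens Y) // σ.LegalUpTo q.2 q.1}, fun p => σ.reply p.1.2 p.1.1,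
    fun p p' => p'.1.1 = p.1.1 + 1 ∧ ∀ j ≤ p.1.1, p'.1.2 j = p.1.2 j,
    ⟨⟨(0, fun _ => ⊤), ?_⟩⟩, fun p => (σ.reply p.1.2 p.1.1).isOpen,
    fun p => ((hσ p.1.2).1 _ p.2).1, ?_, ?_⟩
  · exact ⟨fun k _ => by simp, fun k hk => absurd hk (Nat.not_lt_zero k)⟩
  · rintro ⟨⟨n, U⟩, hU⟩ O hO hne hsub
    have hagree : ∀ j ≤ n, U j = Function.update U (n + 1) ⟨O, hO⟩ j := fun j hj =>
      (Function.update_of_ne (by omega) _ _).symm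
    have hlegal : σ.LegalUpTo (Function.update U (n + 1) ⟨O, hO⟩) (n + 1) := by
      have hn := hU.congr hagree
      refine ⟨fun k hk => ?_, fun k hk => ?_⟩
      · rcases Nat.le_succ_iff.1 hk with hk | rfl
        · exact hn.1 k hk
        · simpa using hne
      · rcases Nat.lt_succ_iff_lt_or_eq.1 hk with hk | rfl
        · exact hn.2 k hk
        · rw [Function.update_self, ← reply_congr hagree]
          exact hsub
    refine ⟨⟨(n + 1, _), hlegal⟩, ⟨rfl, fun j hj => (hagree j hj).symm⟩, ?_⟩
    have := ((hσ _).1 _ hlegal).2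
    rw [Function.update_self] at this
    exact this
  · intro s hs
    have hidx : ∀ n, (s n).1.1 = (s 0).1.1 + n := by
      intro n
      induction n with
      | zero => rfl
      | succ n ih => rw [(hs n).1, ih, add_assoc]
    have hag : ∀ m n, m ≤ n → ∀ j ≤ (s 0).1.1 + m, (s n).1.2 j = (s m).1.2 j := by
      intro m n hmn j hj
      induction n, hmn using Nat.le_induction with
      | base => rfl
      | succ n hn ih => exact ((hs n).2 j (by rw [hidx]; omega)).trans ih
    have hagree : ∀ n, ∀ j ≤ (s 0).1.1 + n, (s n).1.2 j = (s j).1.2 j := by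
      intro n j hj
      rcases le_total j n with h | h
      · exact hag j n h j (by omega)
      · exact (hag n j h j hj).symm
    -- The diagonal sequence is the infinite play: position `s j` has already fixed move `j`, even
    -- if the chain starts late.
    have hlegal : ∀ n, σ.LegalUpTo (fun j => (s j).1.2 j) n := fun n =>
      ((s n).2.mono ((Nat.le_add_left n _).trans (hidx n).ge)).congr fun j hj => hagree n j (hj.trans (Nat.le_add_left n _))
    obtain ⟨y, hy⟩ := (hσ _).2 hlegal
    refine ⟨y, Set.mem_iInter.2 fun n => ?_⟩
    have := Set.mem_iInter.1 hy (s n).1.1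
    rw [← reply_congr (U := (s n).1.2) (hidx n ▸ hagree n)] at this
    exact this

end ChoquetGame.Strategy

/-- A nonempty open set of Baire-one functions leaves the values outside some finite set free. -/
theorem IsOpen.exists_finset_forall_eqOn {X : Type*} [TopologicalSpace X] {V : Set (baireOne X)} (hV : IsOpen V)
    (hne : V.Nonempty) : ∃ I : Finset X, ∃ g ∈ V, ∀ f : baireOne X,
      (∀ x ∈ I, (f : X → ℝ) x = (g : X → ℝ) x) → f ∈ V := by
  obtain ⟨g, hg⟩ := hne
  obtain ⟨I, δ, hδ, hI⟩ := hV.exists_finset_forall_baireOne hg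
  exact ⟨I, g, hg, fun f hf => hI f fun x hx => by simp [hf x hx, hδ.le]⟩

/-! ### The Choquet property and `λ`-sets -/

section Choquet

variable {X : Type*} [TopologicalSpace X] [MetrizableSpace X]

theorem IsLambdaSet.isChoquetSpace_baireOne (h : IsLambdaSet X) : IsChoquetSpace (baireOne X) := by
  classical
  -- The reply to `O` will be the open box, while the closed box already lies in `O`, so limits
  -- cannot escape. The empty case takes dummy values.
  have hbox : ∀ (O : Opens (baireOne X)) (n : ℕ), ∃ (g : baireOne X) (I : Finset X) (δ : ℝ),
      0 < δ ∧ δ ≤ (1 / 2) ^ n ∧ ((O : Set (baireOne X)).Nonempty → ∀ f : baireOne X,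
        (∀ x ∈ I, |(f : X → ℝ) x - (g : X → ℝ) x| ≤ δ) → f ∈ O) := by
    intro O n
    by_cases hO : (O : Set (baireOne X)).Nonempty
    · obtain ⟨g, hg⟩ := hO
      obtain ⟨I, δ, hδ, hI⟩ := O.isOpen.exists_finset_forall_baireOne hg
      exact ⟨g, I, min δ ((1 / 2) ^ n), lt_min hδ (by positivity), min_le_right _ _,
        fun _ f hf => hI f fun x hx => (hf x hx).trans (min_le_left _ _)⟩
    · exact ⟨0, ∅, (1 / 2) ^ n, by positivity, le_rfl, fun h => absurd h hO⟩
  choose g I δ hδ hδn hI using hbox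
  have hopen : ∀ O n, IsOpen {f : baireOne X | ∀ x ∈ I O n,
      |(f : X → ℝ) x - (g O n : X → ℝ) x| < δ O n} := by
    intro O n
    simp only [Set.ofPred_forall]
    exact isOpen_biInter_finset fun x _ => isOpen_lt
      (((continuous_apply x).comp continuous_subtype_val).sub continuous_const).abs continuous_const
  refine ⟨fun n U => ⟨_, hopen (U (Fin.last n)) n⟩, fun U => ⟨fun n hn => ⟨?_, ?_⟩, fun hU => ?_⟩⟩
  · exact ⟨g (U n) n, fun x _ => by simpa [ChoquetGame.Strategy.reply] using hδ (U n) n⟩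
  · exact fun f hf => hI (U n) n (hn.1 n le_rfl) f fun x hx => (hf x hx).le
  have hne : ∀ n, (U n : Set (baireOne X)).Nonempty := fun n => (hU n).1 n le_rfl
  have hstep : ∀ n, ∀ f ∈ U (n + 1), ∀ x ∈ I (U n) n,
      |(f : X → ℝ) x - (g (U n) n : X → ℝ) x| < δ (U n) n := fun n f hf =>
    (hU (n + 1)).2 n n.lt_succ_self hf
  have hanti : ∀ m n, m ≤ n → U n ≤ U m := fun m n hmn =>
    antitone_nat_of_succ_le (f := U)
      (fun n f hf => hI (U n) n (hne n) f fun x hx => (hstep n f hf x hx).le) hmn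
  -- A coordinate dropped later would be unrestricted in `U (n + 1)`; the value `g + δ` there
  -- violates the strict bound of the previous reply.
  have hmono : Monotone fun n => I (U n) n := by
    refine monotone_nat_of_le_succ fun n x hx => ?_
    by_contra hx'
    obtain ⟨f, hf⟩ := exists_baireOne_eqOn_finset (insert x (I (U (n + 1)) (n + 1)))
      fun y => if y = x then (g (U n) n : X → ℝ) x + δ (U n) n
        else (g (U (n + 1)) (n + 1) : X → ℝ) y
    have hfU : f ∈ U (n + 1) := hI _ _ (hne _) f fun y hy => by
      have hyx : y ≠ x := fun h => hx' (h ▸ hy)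
      simp [hf y (Finset.mem_insert_of_mem hy), hyx, (hδ (U (n + 1)) (n + 1)).le]
    have := hstep n f hfU x hx
    rw [hf x (Finset.mem_insert_self _ _), if_pos rfl, add_sub_cancel_left] at this
    exact (lt_irrefl _) ((le_abs_self _).trans_lt this)
  have hclose : ∀ n m, n < m → ∀ x ∈ I (U n) n,
      |(g (U m) m : X → ℝ) x - (g (U n) n : X → ℝ) x| < δ (U n) n := by
    intro n m hnm
    refine hstep n _ (hanti _ _ hnm (hI (U m) m (hne m) _ fun x _ => ?_))
    simpa using (hδ (U m) m).le
  have hlim : ∀ x, ∃ a, (∃ n, x ∈ I (U n) n) →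
      Tendsto (fun n => (g (U n) n : X → ℝ) x) atTop (𝓝 a) := by
    intro x
    by_cases hx : ∃ n, x ∈ I (U n) n
    · obtain ⟨k, hk⟩ := hx
      obtain ⟨a, ha⟩ := cauchySeq_tendsto_of_complete (u := fun n => (g (U n) n : X → ℝ) x) (by
        rw [Metric.cauchySeq_iff']
        intro ε hε
        obtain ⟨N, hN⟩ := exists_pow_lt_of_lt_one hε (show (1 / 2 : ℝ) < 1 by norm_num)
        refine ⟨max k N, fun n hn => ?_⟩
        rcases hn.eq_or_lt with rfl | hn
        · simpa using hε
        · calc _ < δ (U (max k N)) (max k N) := hclose _ _ hn x (hmono (le_max_left k N) hk)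
            _ ≤ (1 / 2) ^ max k N := hδn _ _
            _ ≤ (1 / 2) ^ N := pow_le_pow_of_le_one (by norm_num) (by norm_num) (le_max_right _ _)
            _ < ε := hN)
      exact ⟨a, fun _ => ha⟩
    · exact ⟨0, fun h => absurd h hx⟩
  choose a ha using hlim
  have hDc : (⋃ n, (I (U n) n : Set X)).Countable :=
    Set.countable_iUnion fun n => Finset.countable_toSet _
  have hf : (⋃ n, (I (U n) n : Set X)).indicator a ∈ baireOne X :=
    mem_baireOne_of_countable_support hDc (h _ hDc) fun x hx => Set.indicator_of_notMem hx _
  have hfU : ∀ n, ⟨_, hf⟩ ∈ U n := fun n => hI (U n) n (hne n) _ fun x hx => by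
    have hx' : x ∈ ⋃ n, (I (U n) n : Set X) := Set.mem_iUnion.2 ⟨n, hx⟩
    simp only [Set.indicator_of_mem hx']
    exact le_of_tendsto ((ha x ⟨n, hx⟩).sub_const _).abs
      ((eventually_gt_atTop n).mono fun m hm => (hclose n m hm x hx).le)
  exact ⟨⟨_, hf⟩, Set.mem_iInter.2 fun n => (hU (n + 1)).2 n n.lt_succ_self (hfU (n + 1))⟩

/-- Two plays alternate against the strategy. Each forces its function above `n` on the points newly
fixed by the other, where it is itself still free. The two limit functions handle the even and odd
batches, whose union with `I` is a countable `G_δ`-set containing the given one. -/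
theorem isLambdaSet_of_isChoquetSpace_baireOne (h : IsChoquetSpace (baireOne X)) :
    IsLambdaSet X := by
  classical
  obtain ⟨σ, hσ⟩ := h
  obtain ⟨P, cur, ext, ⟨p₀⟩, hopen, hne, hext, hchain⟩ := hσ.exists_positions
  intro C hC
  rcases C.eq_empty_or_nonempty with rfl | hCne
  · exact .empty
  obtain ⟨c, rfl⟩ := hC.exists_eq_range hCne
  let Free : P → Finset X → Prop := fun p K => ∃ g : baireOne X, ∀ f : baireOne X,
    (∀ x ∈ K, (f : X → ℝ) x = (g : X → ℝ) x) → f ∈ cur p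
  have hstep : ∀ (n : ℕ) (s : {s : (P × Finset X) × (P × Finset X) //
      Free s.1.1 s.1.2 ∧ Free s.2.1 s.2.2}), ∃ t : P × Finset X, Free t.1 t.2 ∧
        ext s.1.1.1 t.1 ∧ s.1.2.2 ⊆ t.2 ∧ c n ∈ t.2 ∧
        ∀ f ∈ cur t.1, ∀ x ∈ s.1.2.2, x ∉ s.1.1.2 → (n : ℝ) < (f : X → ℝ) x := by
    -- The play at `p`, restricted only on `L`, moves now; the other, at `q`, waits with `K`.
    -- Inserting `c n` ensures that every point of the set is eventually covered.
    rintro n ⟨⟨⟨p, L⟩, ⟨q, K⟩⟩, ⟨g, hg⟩, -⟩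
    obtain ⟨f, hf⟩ := exists_baireOne_eqOn_finset (L ∪ K)
      fun x => if x ∈ L then (g : X → ℝ) x else n + 1
    have hO : IsOpen {f : baireOne X | ∀ x ∈ K, x ∉ L → (n : ℝ) < (f : X → ℝ) x} := by
      simp only [Set.ofPred_forall]
      exact isOpen_biInter_finset fun x _ => isOpen_iInter_of_finite fun _ =>
        isOpen_lt continuous_const ((continuous_apply x).comp continuous_subtype_val)
    obtain ⟨p', hp', hsub⟩ := hext p
      (cur p ∩ {f : baireOne X | ∀ x ∈ K, x ∉ L → (n : ℝ) < (f : X → ℝ) x})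
      ((hopen p).inter hO) ⟨f, hg f fun x hx => by
        simp [hf x (Finset.mem_union_left _ hx), hx], fun x hx hxL => by
        simp [hf x (Finset.mem_union_right _ hx), hxL]⟩ Set.inter_subset_left
    obtain ⟨I, g', -, hI⟩ := (hopen p').exists_finset_forall_eqOn (hne p')
    exact ⟨(p', insert (c n) (K ∪ I)), ⟨g', fun f hf => hI f fun x hx => hf x (by simp [hx])⟩,
      hp', fun x hx => by simp [hx], by simp, fun f hf => (hsub hf).2⟩
  choose next hfree hnext hsub hc hbig using hstep
  obtain ⟨I, g, -, hI⟩ := (hopen p₀).exists_finset_forall_eqOn (hne p₀)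
  have hfree₀ : Free p₀ I := ⟨g, hI⟩
  let s : ℕ → {s : (P × Finset X) × (P × Finset X) // Free s.1.1 s.1.2 ∧ Free s.2.1 s.2.2} :=
    fun n => Nat.rec ⟨((p₀, I), (p₀, I)), hfree₀, hfree₀⟩
      (fun n s => ⟨(s.1.2, next n s), s.2.2, hfree n s⟩) n
  have hplay : ∀ i, ∃ f : baireOne X, ∀ k, f ∈ cur (s (2 * k + i)).1.1.1 := by
    intro i
    obtain ⟨f, hf⟩ := hchain (fun k => (s (2 * k + i)).1.1.1) fun k => by
      have := hnext (2 * k + i) (s (2 * k + i))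
      rw [show 2 * (k + 1) + i = 2 * k + i + 1 + 1 by ring]
      exact this
    exact ⟨f, Set.mem_iInter.1 hf⟩
  let M : ℕ → Set X := fun n => ((s n).1.2.2 \ (s n).1.1.2 : Finset X)
  have hM : ∀ n, (M n).Finite := fun n => Finset.finite_toSet _
  have hG : ∀ i, IsGδ (⋃ n ∈ {n | ∃ k, n = 2 * k + i}, M n) := by
    intro i
    obtain ⟨f, hf⟩ := hplay i
    refine isGδ_biUnion_of_le_baireOne f.2 hM ?_
    rintro n ⟨k, rfl⟩ x hx
    have hfk := hf (k + 1)
    rw [show 2 * (k + 1) + i = 2 * k + i + 1 + 1 by ring] at hfk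
    exact (hbig _ _ f hfk x (Finset.mem_sdiff.1 hx).1 (Finset.mem_sdiff.1 hx).2).le
  let _ := metrizableSpaceMetric X
  have hD : IsGδ ((I : Set X) ∪ ((⋃ n ∈ {n | ∃ k, n = 2 * k + 0}, M n) ∪
      ⋃ n ∈ {n | ∃ k, n = 2 * k + 1}, M n)) :=
    I.finite_toSet.isClosed.isGδ.union ((hG 0).union (hG 1))
  have hDc : ∀ B : Set ℕ, (⋃ n ∈ B, M n).Countable := fun B =>
    B.to_countable.biUnion fun n _ => (hM n).countable
  refine (I.countable_toSet.union ((hDc _).union (hDc _))).isGδ_of_subset hD ?_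
  have hcover : ∀ n, ∀ x ∈ (s n).1.1.2, x ∈ I ∨ ∃ m, x ∈ M m := by
    intro n
    induction n with
    | zero => exact fun x hx => .inl hx
    | succ n ih =>
      intro x hx
      by_cases hx' : x ∈ (s n).1.1.2
      · exact ih x hx'
      · exact .inr ⟨n, Finset.mem_coe.2 (Finset.mem_sdiff.2 ⟨hx, hx'⟩)⟩
  rintro _ ⟨n, rfl⟩
  rcases hcover (n + 2) (c n) (hc n (s n)) with hx | ⟨m, hm⟩
  · exact .inl hx
  · obtain ⟨k, hk⟩ := m.even_or_odd'
    rcases hk with hk | hk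
    · exact .inr (.inl (Set.mem_iUnion₂.2 ⟨m, ⟨k, hk⟩, hm⟩))
    · exact .inr (.inr (Set.mem_iUnion₂.2 ⟨m, ⟨k, hk⟩, hm⟩))

theorem isChoquetSpace_baireOne_iff : IsChoquetSpace (baireOne X) ↔ IsLambdaSet X :=
  ⟨isLambdaSet_of_isChoquetSpace_baireOne, IsLambdaSet.isChoquetSpace_baireOne⟩

end Choquet

theorem theorem4p2 (X : Type*) [TopologicalSpace X] [SeparableSpace X] [MetrizableSpace X] :
    (PolishSpace (baireOne X) ↔ Countable X) ∧
    (CompleteSpace (baireOne X) ↔ baireOne X = ⊤) ∧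
    (CompleteSpace (baireOne X) ↔ IsQSet X) ∧
    (IsSequentiallyComplete (baireOne X) ↔ IsSigmaSet X) ∧
    (IsChoquetSpace (baireOne X) ↔ IsLambdaSet X) ∧
    (BaireSpace (baireOne X) ↔ IsKappaSet X) :=
  ⟨polishSpace_baireOne_iff, completeSpace_baireOne_iff,
    completeSpace_baireOne_iff.trans baireOne_eq_top_iff_isQSet,
    isSequentiallyComplete_baireOne_iff, isChoquetSpace_baireOne_iff, baireSpace_baireOne_iff⟩
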